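/- All Banach spaces are real. For a nonempty bounded subset $C$ of a Banach space $X$, a slice of $C$ is a set $S(C,x^*,\alpha)=\{x\in C: x^*(x)>\sup x^*(C)-\alpha\}$ with $x^*\in X^*$ and $\alpha>0$; a convex combination of slices of $C$ is a set $\sum_{i=1}^n\lambda_i S_i=\{\sum_{i=1}^n\lambda_i x_i : x_i\in S_i\}$ with $n\ge 1$, $S_1,\dots,S_n$ slices of $C$, $\lambda_i\ge 0$ and $\sum_{i=1}^n\lambda_i=1$. A Banach space $X$ is strongly regular if every nonempty closed, convex and bounded subset of $X$ has convex combinations of slices of arbitrarily small diameter; $X$ has the Ball Small Combination of Slice Property ($BSCSP$) if its closed unit ball $B_X$ has convex combinations of slices of arbitrarily small diameter. Proposition. Let $X$ be a Banach space and let $Y$ be a closed subspace of $X$. If the quotient space $X/Y$ (with the quotient norm) is strongly regular and $Y$ has $BSCSP$, then $X$ has $BSCSP$. -/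

import Mathlib

/-- The slice `S(C, f, α) = {x ∈ C : f x > sup f(C) - α}` of a set `C` determined by a continuous
linear functional `f` and a number `α`. It is used only for nonempty bounded `C` and `α > 0`. -/
def slice {E : Type*} [NormedAddCommGroup E] [NormedSpace ℝ E]
    (C : Set E) (f : E →L[ℝ] ℝ) (α : ℝ) : Set E :=
  {x | x ∈ C ∧ sSup (f '' C) - α < f x}

/-- `S` is a convex combination `∑ i, w i • S i` of finitely many slices `S i` of `C`.
(The zero functional is admitted; its slice is all of `C`, which contains every other slice, so in
a nonzero space this does not affect the existence of combinations of small diameter.) -/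
def IsConvexCombOfSlices {E : Type*} [NormedAddCommGroup E] [NormedSpace ℝ E]
    (C S : Set E) : Prop :=
  ∃ (n : ℕ) (w : Fin n → ℝ) (f : Fin n → (E →L[ℝ] ℝ)) (α : Fin n → ℝ),
    (∀ i, 0 ≤ w i) ∧ ∑ i, w i = 1 ∧ (∀ i, 0 < α i) ∧
      S = {y | ∃ x : Fin n → E, (∀ i, x i ∈ slice C (f i) (α i)) ∧ y = ∑ i, w i • x i}

/-- `C` has convex combinations of slices of arbitrarily small diameter. -/
def HasSmallCombOfSlices {E : Type*} [NormedAddCommGroup E] [NormedSpace ℝ E]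
    (C : Set E) : Prop :=
  ∀ ε : ℝ, 0 < ε → ∃ S : Set E, IsConvexCombOfSlices C S ∧ Metric.diam S < ε

/-- Strong regularity: every nonempty closed convex bounded set has convex combinations of slices
of arbitrarily small diameter. -/
def StronglyRegular (E : Type*) [NormedAddCommGroup E] [NormedSpace ℝ E] : Prop :=
  ∀ C : Set E, C.Nonempty → IsClosed C → Convex ℝ C → Bornology.IsBounded C →
    HasSmallCombOfSlices C

/-- The Ball Small Combination of Slice Property: the closed unit ball has convex combinations of
slices of arbitrarily small diameter. -/
def BSCSP (E : Type*) [NormedAddCommGroup E] [NormedSpace ℝ E] : Prop :=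
  HasSmallCombOfSlices (Metric.closedBall (0 : E) 1)

/-! Take a combination of slices of the ball of `Y` of diameter below `ε / 4`. A Hahn–Banach
extension turns each slice into a half-space section `A` of the ball of `X`, possibly far from `Y`.
Since `0` lies in the image of `A` in `X ⧸ Y`, strong regularity gives slices of the closure of that
image with a combination close to `0` (`StronglyRegular.containsCombOfSlices_ball`). Each pulls back
to a nonempty two-half-space section of the ball of `X`, which contains a combination of slices by
Bourgain's lemma. Averaging these stays in `A` and lands near `Y`, hence near the original slice.
Averaging once more with the original weights gives a set within `ε / 4` of the small one. -/

/-- Some convex combination of slices of `C` is contained in `U`. -/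
def ContainsCombOfSlices {E : Type*} [NormedAddCommGroup E] [NormedSpace ℝ E]
    (C U : Set E) : Prop :=
  ∃ S : Set E, IsConvexCombOfSlices C S ∧ S ⊆ U

/-! ### Calculus of convex combinations of slices -/

section

variable {E : Type*} [NormedAddCommGroup E] [NormedSpace ℝ E]

theorem ContainsCombOfSlices.mono {C U V : Set E} (h : ContainsCombOfSlices C U) (hUV : U ⊆ V) :
    ContainsCombOfSlices C V := by
  obtain ⟨S, hS, hSU⟩ := h
  exact ⟨S, hS, hSU.trans hUV⟩

/-- Frees the index type from `Fin n`, so that nested combinations can be indexed by a sigma type.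
-/
theorem isConvexCombOfSlices_of_fintype {ι : Type*} [Fintype ι] (C : Set E) (w : ι → ℝ)
    (f : ι → (E →L[ℝ] ℝ)) (α : ι → ℝ) (hw : ∀ i, 0 ≤ w i) (hw1 : ∑ i, w i = 1)
    (hα : ∀ i, 0 < α i) :
    IsConvexCombOfSlices C
      {y | ∃ x : ι → E, (∀ i, x i ∈ slice C (f i) (α i)) ∧ y = ∑ i, w i • x i} := by
  let e := (Fintype.equivFin ι).symm
  refine ⟨Fintype.card ι, w ∘ e, f ∘ e, α ∘ e, fun i => hw _, ?_, fun i => hα _, ?_⟩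
  · rw [← hw1]
    exact Equiv.sum_comp e w
  · ext y
    constructor
    · rintro ⟨x, hx, rfl⟩
      exact ⟨x ∘ e, fun i => hx _, (Equiv.sum_comp e fun i => w i • x i).symm⟩
    · rintro ⟨x, hx, rfl⟩
      refine ⟨x ∘ e.symm, fun i => ?_, ?_⟩
      · simpa using hx (e.symm i)
      · rw [← Equiv.sum_comp e]
        simp

/-- A convex combination of convex combinations of slices is a convex combination of slices. -/
theorem ContainsCombOfSlices.sum {ι : Type*} [Fintype ι] {C : Set E} {w : ι → ℝ} {U : ι → Set E}
    (hw : ∀ i, 0 ≤ w i) (hw1 : ∑ i, w i = 1) (h : ∀ i, ContainsCombOfSlices C (U i)) :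
    ContainsCombOfSlices C {y | ∃ x : ι → E, (∀ i, x i ∈ U i) ∧ y = ∑ i, w i • x i} := by
  choose S hS hSU using h
  choose n v f α hv hv1 hα hSeq using hS
  refine ⟨_, isConvexCombOfSlices_of_fintype (ι := Σ i, Fin (n i)) C (fun p => w p.1 * v p.1 p.2)
    (fun p => f p.1 p.2) (fun p => α p.1 p.2) (fun p => mul_nonneg (hw _) (hv _ _)) ?_
    (fun p => hα _ _), ?_⟩
  · rw [Fintype.sum_sigma]
    simp [← Finset.mul_sum, hv1, hw1]
  · rintro y ⟨x, hx, rfl⟩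
    refine ⟨fun i => ∑ j, v i j • x ⟨i, j⟩, fun i => hSU i ?_, ?_⟩
    · rw [hSeq i]
      exact ⟨fun j => x ⟨i, j⟩, fun j => hx ⟨i, j⟩, rfl⟩
    · rw [Fintype.sum_sigma]
      simp [Finset.smul_sum, mul_smul]

theorem containsCombOfSlices_slice (C : Set E) (f : E →L[ℝ] ℝ) {α : ℝ} (hα : 0 < α) :
    ContainsCombOfSlices C (slice C f α) := by
  refine ⟨_, isConvexCombOfSlices_of_fintype (ι := Unit) C (fun _ => 1) (fun _ => f) (fun _ => α)
    (fun _ => zero_le_one) (by simp) (fun _ => hα), ?_⟩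
  rintro y ⟨x, hx, rfl⟩
  simpa using hx ()

theorem bddAbove_image_of_isBounded {C : Set E} (hb : Bornology.IsBounded C) (f : E →L[ℝ] ℝ) :
    BddAbove (f '' C) :=
  (f.lipschitz.isBounded_image hb).bddAbove

theorem containsCombOfSlices_halfspace {C : Set E} (hb : Bornology.IsBounded C) (f : E →L[ℝ] ℝ)
    {u : ℝ} {x : E} (hx : x ∈ C) (hux : u < f x) :
    ContainsCombOfSlices C {y | y ∈ C ∧ u < f y} := by
  have h : u < sSup (f '' C) :=
    hux.trans_le (le_csSup (bddAbove_image_of_isBounded hb f) ⟨x, hx, rfl⟩)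
  refine (containsCombOfSlices_slice C f (sub_pos.2 h)).mono ?_
  rintro y ⟨hy, hfy⟩
  exact ⟨hy, by linarith⟩

theorem slice_nonempty {C : Set E} (hne : C.Nonempty) (f : E →L[ℝ] ℝ) {α : ℝ} (hα : 0 < α) :
    (slice C f α).Nonempty := by
  obtain ⟨_, ⟨x, hx, rfl⟩, h⟩ :=
    exists_lt_of_lt_csSup (hne.image f) (sub_lt_self (sSup (f '' C)) hα)
  exact ⟨x, hx, h⟩

/-! ### Extreme points and Bourgain's lemma -/

theorem isCompact_convexJoin {s t : Set E} (hs : IsCompact s) (ht : IsCompact t) :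
    IsCompact (convexJoin ℝ s t) := by
  have h : convexJoin ℝ s t =
      (fun p : E × E × ℝ => p.1 + p.2.2 • (p.2.1 - p.1)) '' (s ×ˢ t ×ˢ Set.Icc (0 : ℝ) 1) := by
    ext x
    simp only [mem_convexJoin, segment_eq_image', Set.mem_image, Set.mem_prod, Prod.exists]
    constructor
    · rintro ⟨a, ha, b, hb, θ, hθ, rfl⟩
      exact ⟨a, b, θ, ⟨ha, hb, hθ⟩, rfl⟩
    · rintro ⟨a, b, θ, ⟨ha, hb, hθ⟩, rfl⟩
      exact ⟨a, ha, b, hb, θ, hθ, rfl⟩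
  rw [h]
  exact (hs.prod (ht.prod isCompact_Icc)).image (by fun_prop)

/-- An extreme point of a compact convex set `K` can be avoided by a compact convex subset of `K`
containing a given compact subset of `K` to which the point does not belong. -/
theorem exists_isCompact_convex_notMem_of_mem_extremePoints {K A : Set E} (hK : IsCompact K)
    (hKc : Convex ℝ K) (hA : IsCompact A) (hAK : A ⊆ K) {z : E} (hz : z ∈ K.extremePoints ℝ)
    (hzA : z ∉ A) : ∃ R, IsCompact R ∧ Convex ℝ R ∧ R ⊆ K ∧ A ⊆ R ∧ z ∉ R := by
  -- Small closed balls avoid `z`; finitely many pieces are merged by convex joins, which avoid `z`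
  -- because an extreme point on a segment in `K` is an endpoint.
  refine hA.induction_on (p := fun A => ∃ R, IsCompact R ∧ Convex ℝ R ∧ R ⊆ K ∧ A ⊆ R ∧ z ∉ R)
    ⟨∅, isCompact_empty, convex_empty, Set.empty_subset _, subset_rfl, Set.notMem_empty _⟩ ?_ ?_ ?_
  · rintro s t hst ⟨R, h1, h2, h3, h4, h5⟩
    exact ⟨R, h1, h2, h3, hst.trans h4, h5⟩
  · rintro s t ⟨R, h1, h2, h3, h4, h5⟩ ⟨Q, k1, k2, k3, k4, k5⟩
    rcases R.eq_empty_or_nonempty with rfl | hR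
    · exact ⟨Q, k1, k2, k3, Set.union_subset (h4.trans (Set.empty_subset _)) k4, k5⟩
    rcases Q.eq_empty_or_nonempty with rfl | hQ
    · exact ⟨R, h1, h2, h3, Set.union_subset h4 (k4.trans (Set.empty_subset _)), h5⟩
    refine ⟨convexJoin ℝ R Q, isCompact_convexJoin h1 k1, h2.convexJoin k2, ?_,
      Set.union_subset (h4.trans (subset_convexJoin_left hQ))
        (k4.trans (subset_convexJoin_right hR)), fun hzj => ?_⟩
    · exact convexJoin_subset h3 k3 hKc
    · obtain ⟨a, ha, b, hb, hab⟩ := mem_convexJoin.1 hzj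
      rcases (mem_extremePoints_iff_forall_segment.1 hz).2 a (h3 ha) b (k3 hb) hab with rfl | rfl
      exacts [h5 ha, k5 hb]
  · intro x hx
    have hxz : 0 < dist z x := dist_pos.2 fun h => hzA (h ▸ hx)
    refine ⟨A ∩ Metric.closedBall x (dist z x / 2), Filter.inter_mem self_mem_nhdsWithin
      (mem_nhdsWithin_of_mem_nhds (Metric.closedBall_mem_nhds x (half_pos hxz))),
      K ∩ Metric.closedBall x (dist z x / 2), hK.inter_right Metric.isClosed_closedBall,
      hKc.inter (convex_closedBall _ _), Set.inter_subset_left,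
      Set.inter_subset_inter_left _ hAK, fun h => ?_⟩
    have := Metric.mem_closedBall.1 h.2
    linarith

/-- At an extreme point of a compact convex set, open half-spaces cut out arbitrarily small
neighbourhoods. -/
theorem exists_halfspace_subset_of_mem_extremePoints {K U : Set E} (hK : IsCompact K)
    (hKc : Convex ℝ K) (hU : IsOpen U) {z : E} (hz : z ∈ K.extremePoints ℝ) (hzU : z ∈ U) :
    ∃ (g : E →L[ℝ] ℝ) (u : ℝ), u < g z ∧ ∀ y ∈ K, u < g y → y ∈ U := by
  obtain ⟨R, hR, hRc, -, hKR, hzR⟩ := exists_isCompact_convex_notMem_of_mem_extremePoints hK hKc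
    (hK.diff hU) Set.sdiff_subset hz fun h => h.2 hzU
  obtain ⟨g, u, hg, hu⟩ := geometric_hahn_banach_closed_point hRc hR.isClosed hzR
  exact ⟨g, u, hu, fun y hy huy => by_contra fun hyU => lt_asymm huy (hg y (hKR ⟨hy, hyU⟩))⟩

/-- **Bourgain's lemma**: a nonempty relatively weakly open subset of a bounded convex set contains
a convex combination of slices. -/
theorem containsCombOfSlices_inter_preimage {G : Type*} [NormedAddCommGroup G] [NormedSpace ℝ G]
    [FiniteDimensional ℝ G] {C : Set E} (hC : Convex ℝ C) (hb : Bornology.IsBounded C)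
    (F : E →L[ℝ] G) {V : Set G} (hV : IsOpen V) {x₀ : E} (hx₀ : x₀ ∈ C) (hFx₀ : F x₀ ∈ V) :
    ContainsCombOfSlices C (C ∩ F ⁻¹' V) := by
  have : ProperSpace G := FiniteDimensional.proper ℝ G
  set K := closure (F '' C)
  have hK : IsCompact K := (F.lipschitz.isBounded_image hb).isCompact_closure
  have hKc : Convex ℝ K := (hC.linear_image F.toLinearMap).closure
  -- Krein–Milman: some convex combination `p` of extreme points of `K` lies in `V`.
  have hmem : F x₀ ∈ closure (convexHull ℝ (K.extremePoints ℝ)) := by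
    rw [closure_convexHull_extremePoints hK hKc]
    exact subset_closure ⟨x₀, hx₀, rfl⟩
  obtain ⟨p, hpV, hp⟩ := mem_closure_iff.1 hmem V hV hFx₀
  obtain ⟨r, hr, hrV⟩ := Metric.isOpen_iff.1 hV p hpV
  obtain ⟨ι, _, w, z, hw, hw1, hz, hsum⟩ := mem_convexHull_iff_exists_fintype.1 hp
  have key : ∀ i, ContainsCombOfSlices C (C ∩ F ⁻¹' Metric.ball (z i) r) := by
    intro i
    obtain ⟨g, u, hu, hg⟩ := exists_halfspace_subset_of_mem_extremePoints hK hKc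
      Metric.isOpen_ball (hz i) (Metric.mem_ball_self hr)
    obtain ⟨_, hq, ⟨x, hx, rfl⟩⟩ := mem_closure_iff.1 (hz i).1 {y | u < g y}
      (isOpen_lt continuous_const g.continuous) hu
    refine (containsCombOfSlices_halfspace hb (g.comp F) hx hq).mono ?_
    rintro y ⟨hy, huy⟩
    exact ⟨hy, hg _ (subset_closure ⟨y, hy, rfl⟩) huy⟩
  refine (ContainsCombOfSlices.sum hw hw1 key).mono ?_
  rintro _ ⟨x, hx, rfl⟩
  refine ⟨hC.sum_mem (fun i _ => hw i) hw1 fun i _ => (hx i).1, hrV ?_⟩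
  have h : ∑ i, w i • (F (x i) - z i) ∈ Metric.ball (0 : G) r :=
    (convex_ball (0 : G) r).sum_mem (fun i _ => hw i) hw1 fun i _ => by
      simpa [dist_eq_norm] using (hx i).2
  rw [Metric.mem_ball, dist_eq_norm, ← hsum]
  simpa [smul_sub, Finset.sum_sub_distrib] using h

theorem containsCombOfSlices_inter_halfspaces {C : Set E} (hC : Convex ℝ C)
    (hb : Bornology.IsBounded C) (f g : E →L[ℝ] ℝ) {a b : ℝ} {x : E} (hx : x ∈ C) (hfx : a < f x)
    (hgx : b < g x) : ContainsCombOfSlices C {y | y ∈ C ∧ a < f y ∧ b < g y} :=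
  (containsCombOfSlices_inter_preimage hC hb (f.prod g) (V := Set.Ioi a ×ˢ Set.Ioi b)
    (isOpen_Ioi.prod isOpen_Ioi) hx ⟨hfx, hgx⟩).mono fun _ hy => ⟨hy.1, hy.2.1, hy.2.2⟩

/-! ### Strong regularity localised at points -/

theorem IsConvexCombOfSlices.subset {C S : Set E} (hC : Convex ℝ C)
    (hS : IsConvexCombOfSlices C S) : S ⊆ C := by
  obtain ⟨n, w, f, α, hw, hw1, -, rfl⟩ := hS
  rintro _ ⟨x, hx, rfl⟩
  exact hC.sum_mem (fun i _ => hw i) hw1 fun i _ => (hx i).1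

theorem IsConvexCombOfSlices.nonempty {C S : Set E} (hne : C.Nonempty)
    (hS : IsConvexCombOfSlices C S) : S.Nonempty := by
  obtain ⟨n, w, f, α, -, -, hα, rfl⟩ := hS
  choose x hx using fun i => slice_nonempty hne (f i) (hα i)
  exact ⟨_, x, hx, rfl⟩

/-- A slice of a closed half-space section of `C`, the open section being nonempty, contains a
convex combination of slices of `C`. -/
theorem containsCombOfSlices_slice_section {C : Set E} (hC : Convex ℝ C)
    (hb : Bornology.IsBounded C) (f g : E →L[ℝ] ℝ) {u α : ℝ} {z : E} (hz : z ∈ C) (huz : u < f z)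
    (hα : 0 < α) : ContainsCombOfSlices C (slice {x | x ∈ C ∧ u ≤ f x} g α) := by
  set D : Set E := {x | x ∈ C ∧ u ≤ f x}
  obtain ⟨x, hxD, hx⟩ := slice_nonempty (C := D) ⟨z, hz, huz.le⟩ g hα
  -- A small move from `x` towards `z` makes the inequality for `f` strict and keeps the one for
  -- `g`.
  have hcont : ContinuousAt (fun t : ℝ => g (x + t • (z - x))) 0 := by fun_prop
  have hev : ∀ᶠ t in nhds (0 : ℝ), sSup (g '' D) - α < g (x + t • (z - x)) :=
    hcont.eventually (lt_mem_nhds (by simpa using hx))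
  obtain ⟨t, ht, ht0, ht1⟩ := ((hev.filter_mono nhdsWithin_le_nhds).and
    (Ioo_mem_nhdsGT (zero_lt_one' ℝ))).exists
  have hy : x + t • (z - x) ∈ C := hC.add_smul_sub_mem hxD.1 hz ⟨ht0.le, ht1.le⟩
  have hfy : u < f (x + t • (z - x)) := by
    have h1 : u ≤ f x := hxD.2
    simp only [map_add, map_smul, map_sub, smul_eq_mul]
    nlinarith
  refine (containsCombOfSlices_inter_halfspaces hC hb f g hy hfy ht).mono ?_
  rintro y ⟨hyC, hy1, hy2⟩
  exact ⟨⟨hyC, hy1.le⟩, hy2⟩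

/-- Averaging does not increase errors. Convexity lets Hahn–Banach separate a point from the closure
of this set. -/
theorem convex_setOf_containsCombOfSlices_closedBall (C : Set E) (ε : ℝ) :
    Convex ℝ {x | ContainsCombOfSlices C (Metric.closedBall x ε)} := by
  intro x hx y hy a b ha hb hab
  have hw : ∀ i, 0 ≤ (![a, b] : Fin 2 → ℝ) i := by
    intro i; fin_cases i <;> simpa
  have h := ContainsCombOfSlices.sum (C := C) (w := ![a, b])
    (U := ![Metric.closedBall x ε, Metric.closedBall y ε]) hw (by simpa using hab)
    (by intro i; fin_cases i; exacts [hx, hy])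
  refine h.mono ?_
  rintro _ ⟨p, hp, rfl⟩
  have h0 : p 0 - x ∈ Metric.closedBall (0 : E) ε := by
    simpa [dist_eq_norm] using hp 0
  have h1 : p 1 - y ∈ Metric.closedBall (0 : E) ε := by
    simpa [dist_eq_norm] using hp 1
  have h2 := convex_closedBall (0 : E) ε h0 h1 ha hb hab
  rw [mem_closedBall_zero_iff] at h2
  rw [Metric.mem_closedBall, dist_eq_norm]
  have h3 : ∑ i, (![a, b] : Fin 2 → ℝ) i • p i - (a • x + b • y) =
      a • (p 0 - x) + b • (p 1 - y) := by
    rw [Fin.sum_univ_two, smul_sub, smul_sub]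
    exact add_sub_add_comm _ _ _ _
  rwa [h3]

/-- In a strongly regular space, every ball centred at a point of a closed convex bounded set
contains a convex combination of slices of that set. -/
theorem StronglyRegular.containsCombOfSlices_ball (hE : StronglyRegular E) {C : Set E}
    (hcl : IsClosed C) (hC : Convex ℝ C) (hb : Bornology.IsBounded C) {z : E} (hz : z ∈ C)
    {ε : ℝ} (hε : 0 < ε) : ContainsCombOfSlices C (Metric.ball z ε) := by
  set Z : Set E := {x | ContainsCombOfSlices C (Metric.closedBall x (ε / 2))}
  have hzZ : z ∈ closure Z := by
    by_contra hzZ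
    obtain ⟨f, u, hf, hu⟩ := geometric_hahn_banach_closed_point
      (convex_setOf_containsCombOfSlices_closedBall C (ε / 2)).closure isClosed_closure hzZ
    set D : Set E := {x | x ∈ C ∧ u ≤ f x}
    have hD : D = C ∩ {x | u ≤ f x} := rfl
    have hDne : D.Nonempty := ⟨z, hz, hu.le⟩
    have hDc : Convex ℝ D := by
      rw [hD]
      exact hC.inter (convex_halfSpace_ge f.toLinearMap.isLinear u)
    have hDcl : IsClosed D := hcl.inter (isClosed_le continuous_const f.continuous)
    have hDb : Bornology.IsBounded D := hb.subset fun x hx => hx.1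
    obtain ⟨S, hS, hdiam⟩ := hE D hDne hDcl hDc hDb (ε / 2) (half_pos hε)
    obtain ⟨p, hp⟩ := hS.nonempty hDne
    have hSD : S ⊆ D := hS.subset hDc
    have hSball : S ⊆ Metric.closedBall p (ε / 2) := fun q hq =>
      (Metric.dist_le_diam_of_mem (hDb.subset hSD) hq hp).trans hdiam.le
    -- Slices of `D` contain combinations of slices of `C`, so `p` is in `Z` although `u ≤ f p`.
    have hpZ : p ∈ Z := by
      obtain ⟨n, w, g, α, hw, hw1, hα, rfl⟩ := hS
      exact (ContainsCombOfSlices.sum hw hw1 fun i =>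
        containsCombOfSlices_slice_section hC hb f (g i) hz hu (hα i)).mono hSball
    exact absurd (hf p (subset_closure hpZ)) (not_lt.2 (hSD hp).2)
  obtain ⟨x, hx, hzx⟩ := Metric.mem_closure_iff.1 hzZ (ε / 2) (half_pos hε)
  refine ContainsCombOfSlices.mono hx fun y hy => ?_
  rw [Metric.mem_closedBall] at hy
  rw [Metric.mem_ball]
  have := dist_triangle y x z
  rw [dist_comm z x] at hzx
  linarith

end

/-! ### Lifting slices through the quotient -/

section

variable {X : Type*} [NormedAddCommGroup X] [NormedSpace ℝ X]

/-- A nonempty intersection of `Y` with an open half-space section of a bounded convex set `B` can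
be approached by convex combinations of slices of `B` inside the section, provided that `X ⧸ Y` is
strongly regular. -/
theorem containsCombOfSlices_near_subspace (Y : Submodule ℝ X) [hY : IsClosed (Y : Set X)]
    (hXY : StronglyRegular (X ⧸ Y)) {B : Set X} (hB : Convex ℝ B) (hb : Bornology.IsBounded B)
    (f : X →L[ℝ] ℝ) {u : ℝ} {y : X} (hyY : y ∈ Y) (hyB : y ∈ B) (huy : u < f y) {η : ℝ}
    (hη : 0 < η) :
    ContainsCombOfSlices B {x | x ∈ B ∧ u < f x ∧ ∃ y ∈ Y, ‖x - y‖ < η} := by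
  set P : X →L[ℝ] X ⧸ Y := Y.mkQL
  set A : Set X := {x | x ∈ B ∧ u < f x}
  have hA : Convex ℝ A := hB.inter (convex_halfSpace_gt f.toLinearMap.isLinear u)
  have hAb : Bornology.IsBounded A := hb.subset fun x hx => hx.1
  set C := closure (P '' A)
  have hC : Convex ℝ C := (hA.linear_image P.toLinearMap).closure
  have hCb : Bornology.IsBounded C := (P.lipschitz.isBounded_image hAb).closure
  have h0 : (0 : X ⧸ Y) ∈ C :=
    subset_closure ⟨y, ⟨hyB, huy⟩, (Submodule.Quotient.mk_eq_zero Y).2 hyY⟩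
  obtain ⟨S, ⟨n, w, g, α, hw, hw1, hα, rfl⟩, hS⟩ :=
    hXY.containsCombOfSlices_ball isClosed_closure hC hCb h0 hη
  have key : ∀ i, ContainsCombOfSlices B
      {x | x ∈ B ∧ u < f x ∧ sSup (g i '' C) - α i < ((g i).comp P) x} := by
    intro i
    obtain ⟨q, hq, hq'⟩ := slice_nonempty ⟨0, h0⟩ (g i) (hα i)
    -- The half-space is open, so it meets `P '' A` and not only its closure.
    obtain ⟨_, hx', ⟨x, hx, rfl⟩⟩ := mem_closure_iff.1 hq {y | sSup (g i '' C) - α i < g i y}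
      (isOpen_lt continuous_const (g i).continuous) hq'
    exact containsCombOfSlices_inter_halfspaces hB hb f ((g i).comp P) hx.1 hx.2 hx'
  refine (ContainsCombOfSlices.sum hw hw1 key).mono ?_
  rintro _ ⟨x, hx, rfl⟩
  have hmem : ∑ i, w i • x i ∈ A :=
    hA.sum_mem (fun i _ => hw i) hw1 fun i _ => ⟨(hx i).1, (hx i).2.1⟩
  refine ⟨hmem.1, hmem.2, ?_⟩
  have hP : P (∑ i, w i • x i) ∈ Metric.ball (0 : X ⧸ Y) η := by
    refine hS ⟨fun i => P (x i), fun i => ⟨subset_closure ⟨x i, ⟨(hx i).1, (hx i).2.1⟩, rfl⟩,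
      (hx i).2.2⟩, by simp⟩
  rw [mem_ball_zero_iff] at hP
  obtain ⟨m, hm, hmη⟩ := Submodule.Quotient.norm_mk_lt (P (∑ i, w i • x i)) (sub_pos.2 hP)
  refine ⟨∑ i, w i • x i - m, (Submodule.Quotient.eq Y).1 hm.symm, ?_⟩
  rw [sub_sub_cancel]
  linarith

/-- A point of the unit ball close to a subspace is close to the unit ball of the subspace. -/
theorem exists_mem_closedBall_norm_sub_lt (Y : Submodule ℝ X) {x : X} (hx : ‖x‖ ≤ 1) {η : ℝ}
    (hη : 0 < η) (h : ∃ y ∈ Y, ‖x - y‖ < η) : ∃ y : Y, ‖y‖ ≤ 1 ∧ ‖x - y‖ < 2 * η := by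
  obtain ⟨y, hy, hxy⟩ := h
  have h1 : (0 : ℝ) < 1 + η := by linarith
  have hyn : ‖y‖ ≤ 1 + η := by
    have := norm_sub_norm_le y x
    rw [norm_sub_rev] at this
    linarith
  refine ⟨(1 + η)⁻¹ • ⟨y, hy⟩, ?_, ?_⟩
  · rw [norm_smul, norm_inv, Real.norm_of_nonneg h1.le]
    exact inv_mul_le_one_of_le₀ hyn h1.le
  · have h2 : ‖y - (1 + η)⁻¹ • y‖ ≤ η := by
      have : y - (1 + η)⁻¹ • y = (η * (1 + η)⁻¹) • y := by
        rw [← one_smul ℝ y, smul_smul, ← sub_smul]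
        simp only [one_smul, mul_one]
        congr 1
        field_simp
        ring
      rw [this, norm_smul, Real.norm_of_nonneg (by positivity), mul_assoc]
      exact mul_le_of_le_one_right hη.le (inv_mul_le_one_of_le₀ hyn h1.le)
    have h3 := norm_sub_le_norm_sub_add_norm_sub x y ((1 + η)⁻¹ • y)
    have h4 : ((((1 + η)⁻¹ • (⟨y, hy⟩ : Y) : Y)) : X) = (1 + η)⁻¹ • y := rfl
    rw [h4]
    linarith

/-- If `X ⧸ Y` is strongly regular, each slice of the unit ball of `Y` has arbitrarily small
neighbourhoods containing a convex combination of slices of the unit ball of `X`. -/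
theorem containsCombOfSlices_near_slice (Y : Submodule ℝ X) [hY : IsClosed (Y : Set X)]
    (hXY : StronglyRegular (X ⧸ Y)) (f : Y →L[ℝ] ℝ) {α δ : ℝ} (hα : 0 < α) (hδ : 0 < δ) :
    ContainsCombOfSlices (Metric.closedBall (0 : X) 1)
      {x | ∃ y ∈ slice (Metric.closedBall (0 : Y) 1) f α, ‖x - y‖ < δ} := by
  obtain ⟨F, hF, -⟩ := exists_extension_norm_eq Y f
  set s := sSup (f '' Metric.closedBall (0 : Y) 1)
  obtain ⟨y, hy, hsy⟩ := slice_nonempty (C := Metric.closedBall (0 : Y) 1)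
    ⟨0, Metric.mem_closedBall_self zero_le_one⟩ f (half_pos hα)
  -- Moving by `2 * η` costs at most `δ` in norm and `α / 2` in `F`; the other `α / 2` is spent on
  -- the threshold `s - α / 2`.
  set η := min (δ / 2) (α / (4 * (‖F‖ + 1)))
  have hn : 0 < ‖F‖ + 1 := by positivity
  have hη : 0 < η := by positivity
  have hηδ : 2 * η ≤ δ := by
    have : η ≤ δ / 2 := min_le_left _ _
    linarith
  have hηα : ‖F‖ * (2 * η) ≤ α / 2 := by
    have h1 : η ≤ α / (4 * (‖F‖ + 1)) := min_le_right _ _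
    rw [le_div_iff₀ (by positivity)] at h1
    nlinarith
  refine (containsCombOfSlices_near_subspace Y hXY (convex_closedBall 0 1)
    Metric.isBounded_closedBall F (u := s - α / 2) y.2 (by simpa using hy) (by rw [hF]; exact hsy)
    hη).mono ?_
  rintro x ⟨hxB, hxF, hxY⟩
  obtain ⟨v, hv, hxv⟩ := exists_mem_closedBall_norm_sub_lt Y (by simpa using hxB) hη hxY
  refine ⟨v, ⟨by simpa using hv, ?_⟩, hxv.trans_le hηδ⟩
  have h1 : F x - F v ≤ α / 2 := by
    rw [← map_sub]
    refine (le_abs_self _).trans ((F.le_opNorm _).trans (le_trans ?_ hηα))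
    gcongr
  rw [hF] at h1
  linarith

end

theorem mainTheorem2 {X : Type*} [NormedAddCommGroup X] [NormedSpace ℝ X] [CompleteSpace X]
    (Y : Submodule ℝ X) [hY : IsClosed (Y : Set X)]
    (hXY : StronglyRegular (X ⧸ Y)) (hYB : BSCSP Y) : BSCSP X := by
  intro ε hε
  obtain ⟨S, hS, hdiam⟩ := hYB (ε / 4) (by linarith)
  -- `Metric.diam` is `0` on unbounded sets, so `hdiam` bounds distances only once `S` is bounded.
  have hSb : Bornology.IsBounded S :=
    Metric.isBounded_closedBall.subset (hS.subset (convex_closedBall 0 1))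
  obtain ⟨n, w, f, α, hw, hw1, hα, rfl⟩ := hS
  obtain ⟨T, hT, hTU⟩ := ContainsCombOfSlices.sum hw hw1 fun i =>
    containsCombOfSlices_near_slice Y hXY (f i) (hα i) (δ := ε / 4) (by linarith)
  refine ⟨T, hT, lt_of_le_of_lt (Metric.diam_le_of_forall_dist_le (C := 3 * (ε / 4))
    (by positivity) ?_) (by linarith)⟩
  have key : ∀ x ∈ T, ∃ y ∈ {y : Y | ∃ x : Fin n → Y,
      (∀ i, x i ∈ slice (Metric.closedBall 0 1) (f i) (α i)) ∧ y = ∑ i, w i • x i},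
      dist x (y : X) ≤ ε / 4 := by
    intro x hx
    obtain ⟨p, hp, rfl⟩ := hTU hx
    choose y hy hpy using hp
    refine ⟨∑ i, w i • y i, ⟨y, hy, rfl⟩, ?_⟩
    have h := (convex_closedBall (0 : X) (ε / 4)).sum_mem (t := Finset.univ) (w := w)
      (z := fun i => p i - (y i : X)) (fun i _ => hw i) hw1
      fun i _ => mem_closedBall_zero_iff.2 (hpy i).le
    rw [mem_closedBall_zero_iff] at h
    rw [dist_eq_norm]
    simpa [smul_sub, Finset.sum_sub_distrib] using h
  intro a ha b hb
  obtain ⟨a', ha', haa'⟩ := key a ha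
  obtain ⟨b', hb', hbb'⟩ := key b hb
  have h1 : dist (a' : X) (b' : X) ≤ ε / 4 :=
    (Metric.dist_le_diam_of_mem hSb ha' hb').trans hdiam.le
  have h2 := dist_triangle4_right a b (a' : X) (b' : X)
  have h3 := dist_triangle a (a' : X) b
  have h4 := dist_triangle (a' : X) (b' : X) b
  rw [dist_comm (b' : X) b] at h4
  linarith
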